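/- **Fully explicit no-arbitrage domain for SSVI.** Let $|\rho|<1$ and $\sigma>0$. The SSVI smile with parameters $(b,\rho,\sigma)$ is the total implied variance $$w_{b,\rho,\sigma}(k)=b\sigma\Bigl(\sqrt{1-\rho^2}+\rho\Bigl(\tfrac k\sigma+\tfrac{\rho}{\sqrt{1-\rho^2}}\Bigr)+\sqrt{\Bigl(\tfrac k\sigma+\tfrac{\rho}{\sqrt{1-\rho^2}}\Bigr)^2+1}\Bigr),\qquad k\in\mathbb R.$$ A smile $w$ is called (Butterfly) arbitrage-free if $w(k)>0$ for all $k$ and the curve of normalized Black–Scholes call prices $C(\kappa)=\Phi(d_+)-\kappa\,\Phi(d_-)$, $d_\pm=-\frac{\log\kappa}{\sqrt{w(\log\kappa)}}\pm\frac{\sqrt{w(\log\kappa)}}2$ ($\kappa>0$, $\Phi$ the standard normal distribution function), $C(0)=1$, is convex on $[0,\infty)$ and satisfies $(1-\kappa)^+\le C(\kappa)\le 1$. Notation, for $|\rho|<1$ (primes are derivatives in $l$): $N(l)=\sqrt{1-\rho^2}+\rho l+\sqrt{l^2+1}$, and $$h(l,\rho)=1-\frac{N'(l)}{2N(l)}\Bigl(l-\frac{\rho}{\sqrt{1-\rho^2}}\Bigr),\quad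 g(l,\rho)=\frac{N'(l)}4,\quad g_2(l,\rho)=N''(l)-\frac{N'(l)^2}{2N(l)},\quad \tilde f(l;b,\rho)=-\frac{h(l,\rho)^2-b^2g(l,\rho)^2}{g_2(l,\rho)},$$ $$b^*(l,\rho)=\sqrt{\frac{h\,(h g_2'-2h'g_2)}{g\,(g g_2'-2g'g_2)}}\,(l,\rho),\qquad \sigma^*(l,\rho)=-\frac{b^*(l,\rho)\,g_2(l,\rho)}{2\bigl(h(l,\rho)^2-b^*(l,\rho)^2g(l,\rho)^2\bigr)},\qquad l_2(\rho)=\frac1{\tan\bigl(\tfrac13\arccos(-\rho)\bigr)},$$ where $b^*(l,\rho)$ is defined at those $l$ where the denominator is nonzero and the radicand is nonnegative. Then: 1. If the SSVI smile $w_{b,\rho,\sigma}$ ($b\in\mathbb R$) is arbitrage-free, then $0<b\le\frac{2}{1+|\rho|}$. 2. If $b=\frac2{1+|\rho|}$, then $w_{b,\rho,\sigma}$ is arbitrage-free if and only if $\sigma\ge\sqrt{1-\rho^2}$. 3. Assume that for every $\beta\in[0,\frac2{1+|\rho|})$ the function $\tilde f(\cdot\,;\beta,|\rho|)$ has a unique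 critical point in $(l_2(|\rho|),\infty)$. Then the equation $b^*(l,|\rho|)=0$ has exactly one root $\bar l(0,|\rho|)$ in $(l_2(|\rho|),\infty)$, and for every $b\in(0,\frac2{1+|\rho|})$ and $\sigma>0$, the smile $w_{b,\rho,\sigma}$ is arbitrage-free if and only if there is $l\in[\bar l(0,|\rho|),\infty)$ such that $w_{b,\rho,\sigma}=w_{b^*(l,|\rho|),\rho,\sigma}$ and $\sigma\ge\sigma^*(l,|\rho|)$. -/

import Mathlib

noncomputable section

namespace SVI

/-! ## Butterfly arbitrage of a total implied variance smile -/

/-- Normalized Black-Scholes call price (unit underlying, strike `κ > 0`, total implied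
volatility `s > 0`). -/
def bsCall (κ s : ℝ) : ℝ :=
  ProbabilityTheory.cdf (ProbabilityTheory.gaussianReal 0 1) (-Real.log κ / s + s / 2) -
    κ * ProbabilityTheory.cdf (ProbabilityTheory.gaussianReal 0 1) (-Real.log κ / s - s / 2)

/-- The call price curve, as a function of the strike `κ ≥ 0`, of the smile whose total implied
variance at log-moneyness `k = log κ` is `w k`. At strike `0` the price is `1`, the value of the
underlying. -/
def callPrice (w : ℝ → ℝ) (κ : ℝ) : ℝ :=
  if κ = 0 then 1 else bsCall κ (√(w (Real.log κ)))

/-- A total implied variance smile is free of Butterfly arbitrage: `w` is positive, and the curve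
of call prices is convex in the strike and lies between `(1 - κ)⁺` and `1`. -/
structure ButterflyArbitrageFree (w : ℝ → ℝ) : Prop where
  pos : ∀ k, 0 < w k
  convexOn : ConvexOn ℝ (Set.Ici 0) (callPrice w)
  lower : ∀ κ, 0 ≤ κ → max (1 - κ) 0 ≤ callPrice w κ
  upper : ∀ κ, 0 ≤ κ → callPrice w κ ≤ 1

/-! ## SVI and SSVI smiles -/

/-- The SVI total variance. -/
def svi (a b ρ m σ k : ℝ) : ℝ :=
  a + b * (ρ * (k - m) + √((k - m) ^ 2 + σ ^ 2))

/-- The SSVI total variance in its SVI parameters `b, ρ, σ`. -/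
def ssvi (b ρ σ k : ℝ) : ℝ :=
  svi (b * σ * √(1 - ρ ^ 2)) b ρ (-(ρ * σ / √(1 - ρ ^ 2))) σ k

/-- The classical `θ, φ, ρ` form of an SSVI slice is the smile `ssvi b ρ σ` with
`b = θ φ / 2` and `σ = √(1 - ρ²) / φ`. -/
theorem ssvi_classical {θ φ ρ : ℝ} (hφ : 0 < φ) (hρ : |ρ| < 1) (k : ℝ) :
    ssvi (θ * φ / 2) ρ (√(1 - ρ ^ 2) / φ) k =
      θ / 2 * (1 + ρ * φ * k + √((φ * k + ρ) ^ 2 + (1 - ρ ^ 2))) := by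
  have h1 : 0 < 1 - ρ ^ 2 := by
    have := (sq_lt_one_iff_abs_lt_one ρ).2 hρ
    linarith
  have hs : 0 < √(1 - ρ ^ 2) := Real.sqrt_pos.2 h1
  have hsq : √(1 - ρ ^ 2) ^ 2 = 1 - ρ ^ 2 := Real.sq_sqrt h1.le
  have hm : ρ * (√(1 - ρ ^ 2) / φ) / √(1 - ρ ^ 2) = ρ / φ := by
    field_simp
  have hr : (k - -(ρ / φ)) ^ 2 + (√(1 - ρ ^ 2) / φ) ^ 2 =
      ((φ * k + ρ) ^ 2 + (1 - ρ ^ 2)) / φ ^ 2 := by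
    rw [div_pow, hsq]
    field_simp
    ring
  unfold ssvi svi
  rw [hm, hr, Real.sqrt_div (by positivity), Real.sqrt_sq hφ.le]
  have ha : θ * φ / 2 * (√(1 - ρ ^ 2) / φ) * √(1 - ρ ^ 2) = θ / 2 * (1 - ρ ^ 2) := by
    have e : θ * φ / 2 * (√(1 - ρ ^ 2) / φ) * √(1 - ρ ^ 2) = θ / 2 * √(1 - ρ ^ 2) ^ 2 := by
      field_simp
    rw [e, hsq]
  rw [ha]
  field_simp
  ring

/-! ## The auxiliary functions of the rescaled variable `l = (k - m) / σ`,
with `γ = a / (b σ)` and `μ = m / σ` -/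

/-- The rescaled total variance `N(l; γ, ρ)`. -/
def N (γ ρ l : ℝ) : ℝ := γ + ρ * l + √(l ^ 2 + 1)

/-- `N'(l; ρ)`. -/
def N' (ρ l : ℝ) : ℝ := ρ + l / √(l ^ 2 + 1)

/-- `N''(l) = (l² + 1)^(-3/2)`. -/
def N'' (l : ℝ) : ℝ := 1 / √(l ^ 2 + 1) ^ 3

theorem hasDerivAt_N (γ ρ l : ℝ) : HasDerivAt (N γ ρ) (N' ρ l) l := by
  have h0 : l ^ 2 + 1 ≠ 0 := by positivity
  have h1 : HasDerivAt (fun x : ℝ => x ^ 2 + 1) (2 * l) l := by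
    simpa using (hasDerivAt_pow 2 l).add_const 1
  have h2 := ((((hasDerivAt_id l).const_mul ρ).const_add γ).add (h1.sqrt h0))
  have h3 : N' ρ l = ρ * 1 + 2 * l / (2 * √(l ^ 2 + 1)) := by
    unfold N'
    rw [mul_div_mul_left _ _ two_ne_zero, mul_one]
  rw [h3]
  exact h2

theorem hasDerivAt_N' (ρ l : ℝ) : HasDerivAt (N' ρ) (N'' l) l := by
  have h0 : l ^ 2 + 1 ≠ 0 := by positivity
  have hp : 0 < √(l ^ 2 + 1) := by positivity
  have hsq : √(l ^ 2 + 1) ^ 2 = l ^ 2 + 1 := Real.sq_sqrt (by positivity)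
  have h1 : HasDerivAt (fun x : ℝ => x ^ 2 + 1) (2 * l) l := by
    simpa using (hasDerivAt_pow 2 l).add_const 1
  have h2 := ((hasDerivAt_id l).div (h1.sqrt h0) hp.ne').const_add ρ
  have h3 : N'' l = (1 * √(l ^ 2 + 1) - id l * (2 * l / (2 * √(l ^ 2 + 1)))) /
      √(l ^ 2 + 1) ^ 2 := by
    unfold N''
    simp only [id]
    field_simp
    linarith
  rw [h3]
  exact h2

/-- `h(l; γ, ρ, μ)`. -/
def h (γ ρ μ l : ℝ) : ℝ := 1 - N' ρ l * ((l + μ) / (2 * N γ ρ l))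

/-- `g(l; ρ)`. -/
def g (ρ l : ℝ) : ℝ := N' ρ l / 4

/-- `g₂(l; γ, ρ)`. -/
def g₂ (γ ρ l : ℝ) : ℝ := N'' l - N' ρ l ^ 2 / (2 * N γ ρ l)

/-- `G₁ = (h - b g) (h + b g)`. -/
def G₁ (γ b ρ μ l : ℝ) : ℝ := (h γ ρ μ l - b * g ρ l) * (h γ ρ μ l + b * g ρ l)

/-- `f̃ = -G₁ / g₂`. -/
def fTilde (γ b ρ μ l : ℝ) : ℝ := -(G₁ γ b ρ μ l / g₂ γ ρ l)

end SVI

/-! ## The SSVI case: `γ = √(1 - ρ²)` and `μ = -ρ / √(1 - ρ²)` -/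

namespace SSVI

/-- `h(l, ρ)` for SSVI. -/
def h (ρ l : ℝ) : ℝ := SVI.h (√(1 - ρ ^ 2)) ρ (-(ρ / √(1 - ρ ^ 2))) l

/-- `g(l, ρ)`. -/
def g (ρ l : ℝ) : ℝ := SVI.g ρ l

/-- `g₂(l, ρ)` for SSVI. -/
def g₂ (ρ l : ℝ) : ℝ := SVI.g₂ (√(1 - ρ ^ 2)) ρ l

/-- `f̃(l)` for the SSVI with parameters `b, ρ`. -/
def fTilde (b ρ l : ℝ) : ℝ :=
  SVI.fTilde (√(1 - ρ ^ 2)) b ρ (-(ρ / √(1 - ρ ^ 2))) l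

/-- `h (h g₂' - 2 h' g₂)`, the numerator of `b*²` (primes are derivatives in `l`). -/
def bStarNum (ρ l : ℝ) : ℝ :=
  h ρ l * (h ρ l * deriv (g₂ ρ) l - 2 * deriv (h ρ) l * g₂ ρ l)

/-- `g (g g₂' - 2 g' g₂)`, the denominator of `b*²`. -/
def bStarDen (ρ l : ℝ) : ℝ :=
  g ρ l * (g ρ l * deriv (g₂ ρ) l - 2 * deriv (g ρ) l * g₂ ρ l)

/-- `b*(l, ρ)`. -/
def bStar (ρ l : ℝ) : ℝ := √(bStarNum ρ l / bStarDen ρ l)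

/-- The points where the formula for `b*(l, ρ)` makes sense: the denominator does not vanish and
the radicand is nonnegative. -/
def bStarDomain (ρ : ℝ) : Set ℝ :=
  {l | bStarDen ρ l ≠ 0 ∧ 0 ≤ bStarNum ρ l / bStarDen ρ l}

/-- `σ*(l, ρ)`. -/
def sigmaStar (ρ l : ℝ) : ℝ :=
  -(bStar ρ l * g₂ ρ l / (2 * (h ρ l ^ 2 - bStar ρ l ^ 2 * g ρ l ^ 2)))

/-- `l₂(ρ)`. -/
def l₂ (ρ : ℝ) : ℝ := 1 / Real.tan (Real.arccos (-ρ) / 3)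

/-- `l` is a root of `b*(l, ρ) = 0` in `]l₂(ρ), ∞[` (where `b*` is really defined). -/
def IsBStarRoot (ρ l : ℝ) : Prop := l₂ ρ < l ∧ l ∈ bStarDomain ρ ∧ bStar ρ l = 0

/-- `f̃` has a unique critical point in `]l₂(ρ), ∞[`. -/
def UniqueCriticalPoint (b ρ : ℝ) : Prop :=
  ∃! l, l₂ ρ < l ∧ HasDerivAt (fTilde b ρ) 0 l

end SSVI

end

/-!
Differentiating the call price twice in the strike turns the convexity of the price curve into the
nonnegativity of Durrleman's function of the smile. The bounds `(1 - κ)⁺ ≤ C(κ) ≤ 1` hold for every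
positive smile and make the price continuous at strike `0`, so for a smooth positive smile this is
all that the absence of arbitrage means (`SVI.butterflyArbitrageFree_iff_durrleman`).

For SSVI, in the rescaled variable `l`, Durrleman's function is `h² - b² g² + (b / 2σ) g₂`, and with
`S = √(1 - ρ²)`, `r = √(l² + 1)` the coefficients take the simple form
`h = (1 + 1 / (S r)) / 2`, `g = (ρ + l / r) / 4`, `g₂ = 1 / r³ - (r + ρ l - S) / (2 r²)`
(`SSVI.h_eq`, `SSVI.g₂_eq`). Changing `(ρ, l)` to `(-ρ, -l)` changes nothing, so `ρ ≥ 0` may be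
assumed; then the value at `-l` is at least the value at `l ≥ 0`, because `h` is even while `g²`
grows and `g₂` decreases from `-l` to `l`. So only `l ≥ 0` matters.

* The limit at `+∞` is `1/4 - b² (1 + ρ)² / 16`, whence `b ≤ 2 / (1 + ρ)`.
* If `b = 2 / (1 + ρ)`, the function multiplied by `4 r²` is `2 r (1 / S - 1 / σ)` plus bounded terms
  whose sum is positive for `σ ≥ S`, whence the condition `σ ≥ S`.
* If `b < 2 / (1 + ρ)`, then `h² - b² g² > 0` for `l ≥ 0`, so the condition is only active where
  `g₂ < 0`, that is on `]l₂, ∞[`, and there it reads `f̃ ≥ b / (2σ)`. As `f̃ → +∞` at both ends, its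
  unique critical point is its minimum point, and the condition is `σ ≥ σ*` at this point. Since
  `f̃' = (bStarNum - b² bStarDen) / g₂²`, the critical points for `b` are the solutions of
  `b* = b`, provided `bStarNum` and `bStarDen` have no common zero (`SSVI.bStarDen_pos`). Finally
  `f̃ = (h² / -g₂) (1 - b² (g / h)²)` with `g / h` increasing, so the minimum point for `b > 0` does
  not lie to the left of the one for `b = 0`, the root of `b*` (`SSVI.minimizer_zero_le`).
-/

namespace SVI

open Filter Topology Set ProbabilityTheory

local notation "Φ" => ProbabilityTheory.cdf (ProbabilityTheory.gaussianReal 0 1)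

local notation "φ" => ProbabilityTheory.gaussianPDFReal 0 1

/-! ### The normal distribution and the Black-Scholes price -/

theorem gaussianPDFReal_zero_one (x : ℝ) :
    φ x = (√(2 * Real.pi))⁻¹ * Real.exp (-x ^ 2 / 2) := by
  simp [gaussianPDFReal]

theorem gaussianPDFReal_zero_one_pos (x : ℝ) : 0 < φ x :=
  gaussianPDFReal_pos 0 1 x one_ne_zero

theorem continuous_gaussianPDFReal_zero_one : Continuous φ := by
  rw [funext gaussianPDFReal_zero_one]
  fun_prop

theorem cdf_gaussianReal_eq_integral (x : ℝ) : Φ x = ∫ y in Iic x, φ y := by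
  rw [cdf_eq_real, MeasureTheory.measureReal_def, gaussianReal_apply_eq_integral _ one_ne_zero,
    ENNReal.toReal_ofReal]
  exact MeasureTheory.integral_nonneg fun y => gaussianPDFReal_nonneg _ _ y

theorem hasDerivAt_cdf_gaussianReal (x : ℝ) : HasDerivAt Φ (φ x) x := by
  have hi := integrable_gaussianPDFReal 0 1
  have hc := continuous_gaussianPDFReal_zero_one
  have e : (Φ : ℝ → ℝ) = fun u => Φ 0 + ∫ y in (0 : ℝ)..u, φ y := by
    funext u
    rw [← intervalIntegral.integral_Iic_sub_Iic hi.integrableOn hi.integrableOn,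
      cdf_gaussianReal_eq_integral, cdf_gaussianReal_eq_integral]
    ring
  rw [e]
  exact (hc.integral_hasStrictDerivAt 0 x).hasDerivAt.const_add _

theorem hasDerivAt_gaussianPDFReal (x : ℝ) : HasDerivAt φ (-x * φ x) x := by
  have h1 : HasDerivAt (fun y : ℝ => -y ^ 2 / 2) (-x) x := by
    have := ((hasDerivAt_pow 2 x).neg).div_const 2
    refine this.congr_deriv ?_
    push_cast
    ring
  have h2 := (h1.exp).const_mul (√(2 * Real.pi))⁻¹
  rw [funext gaussianPDFReal_zero_one]
  refine h2.congr_deriv ?_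
  ring

/-- The Gaussian density at `d₊` and `d₋ = d₊ - s`: `φ(d₋ + s) / φ(d₋) = exp(-s d₋ - s²/2)`. -/
theorem gaussianPDFReal_add (y s : ℝ) :
    φ (y + s) = Real.exp (-s * y - s ^ 2 / 2) * φ y := by
  rw [gaussianPDFReal_zero_one, gaussianPDFReal_zero_one, mul_left_comm, ← Real.exp_add]
  congr 2
  ring

/-- The Black-Scholes price lies above the intrinsic value. With `J y = Φ (y + s) - κ Φ y` the price is
`J d₋`; the likelihood ratio `φ (y + s) / φ y` decreases through `κ` at `d₋`, so `d₋` maximizes `J`,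
whose limits at `-∞` and `+∞` are `0` and `1 - κ`. -/
theorem max_le_bsCall {κ s : ℝ} (hκ : 0 < κ) (hs : 0 < s) : max (1 - κ) 0 ≤ bsCall κ s := by
  set d := -Real.log κ / s - s / 2 with hd
  set J : ℝ → ℝ := fun y => Φ (y + s) - κ * Φ y with hJ
  have hJd : bsCall κ s = J d := by
    simp only [bsCall, hJ]
    rw [show d + s = -Real.log κ / s + s / 2 by rw [hd]; ring]
  have hder : ∀ y, HasDerivAt J (φ (y + s) - κ * φ y) y := fun y =>
    ((hasDerivAt_cdf_gaussianReal (y + s)).comp_add_const y s).sub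
      ((hasDerivAt_cdf_gaussianReal y).const_mul κ)
  have hcont : Continuous J :=
    continuous_iff_continuousAt.2 fun y => (hder y).continuousAt
  have hsd : -s * d - s ^ 2 / 2 = Real.log κ := by
    rw [hd]
    field_simp
    ring
  have hmono : MonotoneOn J (Iic d) := by
    refine monotoneOn_of_deriv_nonneg (convex_Iic d) hcont.continuousOn
      (fun y _ => (hder y).differentiableAt.differentiableWithinAt) fun y hy => ?_
    rw [interior_Iic] at hy
    rw [(hder y).deriv, gaussianPDFReal_add, ← sub_mul]
    refine mul_nonneg ?_ (gaussianPDFReal_zero_one_pos y).le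
    rw [sub_nonneg, ← Real.log_le_iff_le_exp hκ, ← hsd]
    nlinarith [hy.out]
  have hanti : AntitoneOn J (Ici d) := by
    refine antitoneOn_of_deriv_nonpos (convex_Ici d) hcont.continuousOn
      (fun y _ => (hder y).differentiableAt.differentiableWithinAt) fun y hy => ?_
    rw [interior_Ici] at hy
    rw [(hder y).deriv, gaussianPDFReal_add, ← sub_mul]
    refine mul_nonpos_of_nonpos_of_nonneg ?_ (gaussianPDFReal_zero_one_pos y).le
    rw [sub_nonpos, ← Real.le_log_iff_exp_le hκ, ← hsd]
    nlinarith [hy.out]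
  rw [hJd]
  refine max_le ?_ ?_
  · have ht : Tendsto J atTop (𝓝 (1 - κ * 1)) :=
      ((tendsto_cdf_atTop _).comp (tendsto_atTop_add_const_right _ s tendsto_id)).sub
        ((tendsto_cdf_atTop _).const_mul κ)
    rw [mul_one] at ht
    refine le_of_tendsto ht ?_
    filter_upwards [eventually_ge_atTop d] with y hy
    exact hanti self_mem_Ici hy hy
  · have ht : Tendsto J atBot (𝓝 (0 - κ * 0)) :=
      ((tendsto_cdf_atBot _).comp (tendsto_atBot_add_const_right _ s tendsto_id)).sub
        ((tendsto_cdf_atBot _).const_mul κ)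
    rw [mul_zero, sub_zero] at ht
    refine le_of_tendsto ht ?_
    filter_upwards [eventually_le_atBot d] with y hy
    exact hmono hy self_mem_Iic hy

theorem bsCall_le_one {κ : ℝ} (s : ℝ) (hκ : 0 < κ) : bsCall κ s ≤ 1 := by
  have h1 := cdf_le_one (gaussianReal 0 1) (-Real.log κ / s + s / 2)
  have h2 := mul_nonneg hκ.le (cdf_nonneg (gaussianReal 0 1) (-Real.log κ / s - s / 2))
  unfold bsCall
  linarith

/-! ### Convexity of the call price curve -/

/-- Durrleman's function of a smile with total variance `x`, first derivative `x'` and second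
derivative `x''` at log-moneyness `k`. Up to a positive factor it is the second derivative of the
call price in the strike. -/
noncomputable def durrleman (k x x' x'' : ℝ) : ℝ :=
  (1 - k * x' / (2 * x)) ^ 2 - x' ^ 2 / 4 * (1 / x + 1 / 4) + x'' / 2

/-- The derivative of the call price in the strike `exp k`, when the total volatility at `k` is `v`
and its derivative is `v'`. -/
noncomputable def strikeDeriv (v v' : ℝ → ℝ) (k : ℝ) : ℝ :=
  -Φ (-k / v k - v k / 2) + φ (-k / v k - v k / 2) * v' k

theorem hasDerivAt_dMinus {v : ℝ → ℝ} {v' k : ℝ} (hpos : 0 < v k) (hv : HasDerivAt v v' k) :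
    HasDerivAt (fun k => -k / v k - v k / 2) (-1 / v k + k * v' / v k ^ 2 - v' / 2) k := by
  have := ((hasDerivAt_neg k).div hv hpos.ne').sub (hv.div_const 2)
  refine this.congr_deriv ?_
  field_simp
  ring

theorem hasDerivAt_bsCall_exp {v : ℝ → ℝ} {v' : ℝ → ℝ} {k : ℝ} (hpos : 0 < v k)
    (hv : HasDerivAt v (v' k) k) :
    HasDerivAt (fun k => bsCall (Real.exp k) (v k)) (Real.exp k * strikeDeriv v v' k) k := by
  have hm := hasDerivAt_dMinus hpos hv
  have hp : HasDerivAt (fun k => -k / v k - v k / 2 + v k)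
      (-1 / v k + k * v' k / v k ^ 2 - v' k / 2 + v' k) k := hm.add hv
  have h1 := ((hasDerivAt_cdf_gaussianReal _).comp k hp).sub
    ((Real.hasDerivAt_exp k).mul ((hasDerivAt_cdf_gaussianReal _).comp k hm))
  -- The identity `φ d₊ = κ φ d₋` cancels the terms with the derivative of `d₋`.
  have hφ : φ (-k / v k - v k / 2 + v k) = Real.exp k * φ (-k / v k - v k / 2) := by
    rw [gaussianPDFReal_add]
    congr 2
    field_simp
    ring
  have e : (fun k => bsCall (Real.exp k) (v k)) =
      fun k => Φ (-k / v k - v k / 2 + v k) - Real.exp k * Φ (-k / v k - v k / 2) := by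
    funext x
    simp only [bsCall, Real.log_exp]
    rw [show -x / v x + v x / 2 = -x / v x - v x / 2 + v x by ring]
  rw [e]
  refine h1.congr_deriv ?_
  rw [hφ]
  simp only [strikeDeriv, Function.comp]
  ring

theorem hasDerivAt_strikeDeriv {v v' : ℝ → ℝ} {v'' k : ℝ} (hpos : 0 < v k)
    (hv : HasDerivAt v (v' k) k) (hv' : HasDerivAt v' v'' k) :
    HasDerivAt (strikeDeriv v v') (φ (-k / v k - v k / 2) / v k *
      ((1 - k * v' k / v k) ^ 2 - v k ^ 2 * v' k ^ 2 / 4 + v k * v'')) k := by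
  have hm := hasDerivAt_dMinus hpos hv
  have h1 := (((hasDerivAt_cdf_gaussianReal _).comp k hm).neg).add
    (((hasDerivAt_gaussianPDFReal _).comp k hm).mul hv')
  refine h1.congr_deriv ?_
  simp only [Function.comp]
  field_simp
  ring

theorem hasDerivAt_callPrice {w : ℝ → ℝ} {v' : ℝ → ℝ} (hw : ∀ k, 0 < w k)
    (hv : ∀ k, HasDerivAt (fun k => √(w k)) (v' k) k) {κ : ℝ} (hκ : 0 < κ) :
    HasDerivAt (callPrice w) (strikeDeriv (fun k => √(w k)) v' (Real.log κ)) κ := by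
  have h1 := (hasDerivAt_bsCall_exp (v := fun k => √(w k)) (v' := v') (Real.sqrt_pos.2 (hw (Real.log κ)))
    (hv (Real.log κ))).comp κ (Real.hasDerivAt_log hκ.ne')
  rw [Real.exp_log hκ] at h1
  have h2 := h1.congr_of_eventuallyEq (f₁ := callPrice w) (by
    filter_upwards [lt_mem_nhds hκ] with x hx
    simp [callPrice, hx.ne', Real.exp_log hx])
  refine h2.congr_deriv ?_
  field_simp

theorem callPrice_mem_Icc {w : ℝ → ℝ} (hw : ∀ k, 0 < w k) {κ : ℝ} (hκ : 0 ≤ κ) :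
    max (1 - κ) 0 ≤ callPrice w κ ∧ callPrice w κ ≤ 1 := by
  rcases hκ.eq_or_lt with rfl | hκ
  · simp [callPrice]
  · rw [callPrice, if_neg hκ.ne']
    exact ⟨max_le_bsCall hκ (Real.sqrt_pos.2 (hw _)), bsCall_le_one _ hκ⟩

/-- A smooth positive smile is arbitrage-free exactly when Durrleman's function is nonnegative: the
price bounds hold for every smile, and they also give the continuity of the price at strike `0`. -/
theorem butterflyArbitrageFree_iff_durrleman {w w' w'' : ℝ → ℝ} (hw : ∀ k, 0 < w k)
    (h1 : ∀ k, HasDerivAt w (w' k) k) (h2 : ∀ k, HasDerivAt w' (w'' k) k) :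
    ButterflyArbitrageFree w ↔ ∀ k, 0 ≤ durrleman k (w k) (w' k) (w'' k) := by
  set v : ℝ → ℝ := fun k => √(w k) with hvdef
  set v' : ℝ → ℝ := fun k => w' k / (2 * √(w k)) with hv'def
  have hvpos : ∀ k, 0 < v k := fun k => Real.sqrt_pos.2 (hw k)
  have hsq : ∀ k, w k = v k ^ 2 := fun k => (Real.sq_sqrt (hw k).le).symm
  have hv : ∀ k, HasDerivAt v (v' k) k := fun k => (h1 k).sqrt (hw k).ne'
  have hv' : ∀ k, HasDerivAt v'
      ((w'' k * (2 * v k) - w' k * (2 * v' k)) / (2 * v k) ^ 2) k := fun k =>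
    (h2 k).div ((hv k).const_mul 2) (by have := hvpos k; positivity)
  have hD : ∀ k, HasDerivAt (strikeDeriv v v') (φ (-k / v k - v k / 2) / v k *
      durrleman k (w k) (w' k) (w'' k)) k := by
    intro k
    have h := hasDerivAt_strikeDeriv (hvpos k) (hv k) (hv' k)
    refine h.congr_deriv ?_
    have hp := (hvpos k).ne'
    have : v' k = w' k / (2 * v k) := rfl
    rw [durrleman, this, hsq]
    congr 1
    field_simp
    ring
  have hfac : ∀ k, 0 < φ (-k / v k - v k / 2) / v k := fun k =>
    div_pos (gaussianPDFReal_zero_one_pos _) (hvpos k)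
  have hC : ∀ κ, 0 < κ → HasDerivAt (callPrice w) (strikeDeriv v v' (Real.log κ)) κ :=
    fun κ hκ => hasDerivAt_callPrice hw hv hκ
  constructor
  · intro hfree k
    have hmono := (hfree.convexOn.subset Ioi_subset_Ici_self (convex_Ioi 0)).monotoneOn_deriv
      fun κ hκ => (hC κ hκ).differentiableAt
    have hDmono : Monotone (strikeDeriv v v') := by
      intro x y hxy
      have := hmono (Real.exp_pos x) (Real.exp_pos y) (Real.exp_le_exp.2 hxy)
      rwa [(hC _ (Real.exp_pos x)).deriv, (hC _ (Real.exp_pos y)).deriv, Real.log_exp,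
        Real.log_exp] at this
    have hnn := hDmono.deriv_nonneg (x := k)
    rw [(hD k).deriv] at hnn
    exact nonneg_of_mul_nonneg_right hnn (hfac k)
  · intro hdur
    have hDmono : Monotone (strikeDeriv v v') := by
      refine monotone_of_deriv_nonneg (fun k => (hD k).differentiableAt) fun k => ?_
      rw [(hD k).deriv]
      exact mul_nonneg (hfac k).le (hdur k)
    have hcont : ContinuousOn (callPrice w) (Ici 0) := by
      intro κ hκ
      rcases (mem_Ici.1 hκ).eq_or_lt with rfl | hκ
      · have h0 : callPrice w 0 = 1 := by simp [callPrice]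
        have hlow : Tendsto (fun κ : ℝ => 1 - κ) (𝓝[Ici 0] 0) (𝓝 1) := by
          have : Tendsto (fun κ : ℝ => 1 - κ) (𝓝 0) (𝓝 (1 - 0)) :=
            tendsto_const_nhds.sub tendsto_id
          rw [sub_zero] at this
          exact this.mono_left nhdsWithin_le_nhds
        rw [ContinuousWithinAt, h0]
        refine tendsto_of_tendsto_of_tendsto_of_le_of_le' hlow tendsto_const_nhds ?_ ?_
        · filter_upwards [self_mem_nhdsWithin] with κ hκ
          exact (le_max_left _ _).trans (callPrice_mem_Icc hw hκ).1
        · filter_upwards [self_mem_nhdsWithin] with κ hκ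
          exact (callPrice_mem_Icc hw hκ).2
      · exact (hC κ hκ).continuousAt.continuousWithinAt
    refine ⟨hw, MonotoneOn.convexOn_of_deriv (convex_Ici 0) hcont ?_ ?_,
      fun κ hκ => (callPrice_mem_Icc hw hκ).1, fun κ hκ => (callPrice_mem_Icc hw hκ).2⟩
    · rw [interior_Ici]
      exact fun κ hκ => (hC κ hκ).differentiableAt.differentiableWithinAt
    · rw [interior_Ici]
      intro x hx y hy hxy
      rw [(hC x hx).deriv, (hC y hy).deriv]
      exact hDmono (Real.log_le_log hx hxy)

end SVI

namespace SSVI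

open Filter Topology Set

/-! ### SSVI in the rescaled variable -/

theorem sqrt_one_sub_sq_pos {ρ : ℝ} (hρ : |ρ| < 1) : 0 < √(1 - ρ ^ 2) :=
  Real.sqrt_pos.2 (sub_pos.2 ((sq_lt_one_iff_abs_lt_one ρ).2 hρ))

theorem sq_sqrt_one_sub_sq {ρ : ℝ} (hρ : |ρ| < 1) : √(1 - ρ ^ 2) ^ 2 = 1 - ρ ^ 2 :=
  Real.sq_sqrt (sub_nonneg.2 ((sq_lt_one_iff_abs_lt_one ρ).2 hρ).le)

theorem sqrt_one_sub_sq_le_one (ρ : ℝ) : √(1 - ρ ^ 2) ≤ 1 :=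
  Real.sqrt_le_one.2 (by nlinarith [sq_nonneg ρ])

theorem sqrt_sq_add_one_pos (l : ℝ) : 0 < √(l ^ 2 + 1) := by positivity

theorem sq_sqrt_sq_add_one (l : ℝ) : √(l ^ 2 + 1) ^ 2 = l ^ 2 + 1 :=
  Real.sq_sqrt (by positivity)

theorem one_le_sqrt_sq_add_one (l : ℝ) : 1 ≤ √(l ^ 2 + 1) :=
  Real.one_le_sqrt.2 (by nlinarith [sq_nonneg l])

theorem lt_sqrt_sq_add_one (l : ℝ) : l < √(l ^ 2 + 1) :=
  Real.lt_sqrt_of_sq_lt (by linarith)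

theorem neg_lt_sqrt_sq_add_one (l : ℝ) : -l < √(l ^ 2 + 1) :=
  Real.lt_sqrt_of_sq_lt (by linarith [neg_sq l])

theorem N_pos {ρ : ℝ} (hρ : |ρ| < 1) (l : ℝ) : 0 < SVI.N √(1 - ρ ^ 2) ρ l := by
  have hS := sqrt_one_sub_sq_pos hρ
  obtain ⟨h1, h2⟩ := abs_lt.1 hρ
  have h3 := lt_sqrt_sq_add_one l
  have h4 := neg_lt_sqrt_sq_add_one l
  unfold SVI.N
  nlinarith [mul_pos (sub_pos.2 h2) (sub_pos.2 h4), mul_pos (sub_pos.2 h1) (sub_pos.2 h3)]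

/-- For SSVI the function `h` depends on `l²` only. The identity amounts to
`(ρ r + l) (S l - ρ) = (S + ρ l + r) (S r - 1)` with `S = √(1 - ρ²)`, `r = √(l² + 1)`. -/
theorem h_eq {ρ : ℝ} (hρ : |ρ| < 1) (l : ℝ) :
    h ρ l = 1 / 2 + 1 / (2 * √(1 - ρ ^ 2) * √(l ^ 2 + 1)) := by
  have hN := N_pos hρ l
  have hS := sqrt_one_sub_sq_pos hρ
  have hS2 := sq_sqrt_one_sub_sq hρ
  have hr := sqrt_sq_add_one_pos l
  have hr2 := sq_sqrt_sq_add_one l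
  unfold h SVI.h SVI.N'
  unfold SVI.N at hN ⊢
  generalize √(1 - ρ ^ 2) = S at *
  generalize √(l ^ 2 + 1) = r at *
  have hN' := hN.ne'
  field_simp
  linear_combination S * hr2 + r * hS2

theorem g_eq (ρ l : ℝ) : g ρ l = (ρ + l / √(l ^ 2 + 1)) / 4 := rfl

/-- For SSVI the quotient `N'² / N` simplifies, because
`(r + ρ l + S) (r + ρ l - S) = (ρ r + l)²` with `S = √(1 - ρ²)`, `r = √(l² + 1)`. -/
theorem g₂_eq {ρ : ℝ} (hρ : |ρ| < 1) (l : ℝ) :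
    g₂ ρ l = 1 / √(l ^ 2 + 1) ^ 3 -
      (√(l ^ 2 + 1) + ρ * l - √(1 - ρ ^ 2)) / (2 * √(l ^ 2 + 1) ^ 2) := by
  have hN := N_pos hρ l
  have hS2 := sq_sqrt_one_sub_sq hρ
  have hr := sqrt_sq_add_one_pos l
  have hr2 := sq_sqrt_sq_add_one l
  unfold g₂ SVI.g₂ SVI.N' SVI.N''
  unfold SVI.N at hN ⊢
  generalize √(1 - ρ ^ 2) = S at *
  generalize √(l ^ 2 + 1) = r at *
  have hN' := hN.ne'
  field_simp
  linear_combination r * (1 - ρ ^ 2) * hr2 - r * hS2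

/-- Durrleman's function of the SSVI smile in the rescaled variable. -/
noncomputable def density (b ρ σ l : ℝ) : ℝ :=
  h ρ l ^ 2 - b ^ 2 * g ρ l ^ 2 + b / (2 * σ) * g₂ ρ l

theorem ssvi_eq {σ : ℝ} (hσ : 0 < σ) (b ρ k : ℝ) :
    SVI.ssvi b ρ σ k =
      b * σ * SVI.N √(1 - ρ ^ 2) ρ (k / σ + ρ / √(1 - ρ ^ 2)) := by
  have e : k - -(ρ * σ / √(1 - ρ ^ 2)) = σ * (k / σ + ρ / √(1 - ρ ^ 2)) := by
    field_simp
    ring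
  unfold SVI.ssvi SVI.svi SVI.N
  rw [e, show (σ * (k / σ + ρ / √(1 - ρ ^ 2))) ^ 2 + σ ^ 2 =
    σ ^ 2 * ((k / σ + ρ / √(1 - ρ ^ 2)) ^ 2 + 1) by ring, Real.sqrt_mul (sq_nonneg σ),
    Real.sqrt_sq hσ.le]
  ring

theorem butterflyArbitrageFree_ssvi_iff_density {ρ σ : ℝ} (hρ : |ρ| < 1) (hσ : 0 < σ) (b : ℝ) :
    SVI.ButterflyArbitrageFree (SVI.ssvi b ρ σ) ↔ 0 < b ∧ ∀ l, 0 ≤ density b ρ σ l := by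
  set μ := ρ / √(1 - ρ ^ 2) with hμ
  have hw : SVI.ssvi b ρ σ = fun k => b * σ * SVI.N √(1 - ρ ^ 2) ρ (k / σ + μ) :=
    funext (ssvi_eq hσ b ρ)
  have key (hb : 0 < b) : SVI.ButterflyArbitrageFree (SVI.ssvi b ρ σ) ↔
      ∀ l, 0 ≤ density b ρ σ l := by
    have hin : ∀ k, HasDerivAt (fun k => k / σ + μ) (1 / σ) k := fun k =>
      ((hasDerivAt_id k).div_const σ).add_const μ
    rw [hw, SVI.butterflyArbitrageFree_iff_durrleman (w' := fun k => b * SVI.N' ρ (k / σ + μ))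
      (w'' := fun k => b / σ * SVI.N'' (k / σ + μ))
      (fun k => mul_pos (mul_pos hb hσ) (N_pos hρ _))
      (fun k => (((SVI.hasDerivAt_N _ ρ _).comp k (hin k)).const_mul (b * σ)).congr_deriv
        (by field_simp))
      (fun k => (((SVI.hasDerivAt_N' ρ _).comp k (hin k)).const_mul b).congr_deriv
        (by field_simp))]
    have hd : ∀ l, SVI.durrleman (σ * (l - μ)) (b * σ * SVI.N √(1 - ρ ^ 2) ρ l)
        (b * SVI.N' ρ l) (b / σ * SVI.N'' l) = density b ρ σ l := by
      intro l
      have hN := (N_pos hρ l).ne'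
      unfold SVI.durrleman density h g g₂ SVI.h SVI.g SVI.g₂
      rw [← hμ]
      field_simp
      ring
    constructor
    · intro H l
      have := H (σ * (l - μ))
      rwa [mul_div_cancel_left₀ _ hσ.ne', sub_add_cancel, hd] at this
    · intro H k
      have := H (k / σ + μ)
      rwa [← hd, add_sub_cancel_right, mul_div_cancel₀ _ hσ.ne'] at this
  constructor
  · intro H
    have hb : 0 < b := by
      have := H.pos 0
      rw [hw] at this
      exact pos_of_mul_pos_left (pos_of_mul_pos_left this (N_pos hρ _).le) hσ.le
    exact ⟨hb, (key hb).1 H⟩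
  · rintro ⟨hb, H⟩
    exact (key hb).2 H

theorem ssvi_eq_ssvi_iff {ρ σ : ℝ} (hρ : |ρ| < 1) (hσ : 0 < σ) (b b' : ℝ) :
    (∀ k, SVI.ssvi b ρ σ k = SVI.ssvi b' ρ σ k) ↔ b = b' := by
  refine ⟨fun H => ?_, fun H k => by rw [H]⟩
  have := H 0
  rw [ssvi_eq hσ, ssvi_eq hσ] at this
  exact mul_right_cancel₀ hσ.ne' (mul_right_cancel₀ (N_pos hρ _).ne' this)

/-- Reflection of the smile. -/
theorem density_neg {ρ : ℝ} (hρ : |ρ| < 1) (b σ l : ℝ) :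
    density b (-ρ) σ (-l) = density b ρ σ l := by
  unfold density
  rw [h_eq hρ, h_eq (by rwa [abs_neg]), g_eq, g_eq, g₂_eq hρ, g₂_eq (by rwa [abs_neg]), neg_sq,
    neg_sq]
  ring

/-- By reflection the sign of `ρ` is irrelevant for the absence of arbitrage. -/
theorem butterflyArbitrageFree_ssvi_iff {ρ σ : ℝ} (hρ : |ρ| < 1) (hσ : 0 < σ) (b : ℝ) :
    SVI.ButterflyArbitrageFree (SVI.ssvi b ρ σ) ↔ 0 < b ∧ ∀ l, 0 ≤ density b |ρ| σ l := by
  rw [butterflyArbitrageFree_ssvi_iff_density hρ hσ]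
  rcases abs_choice ρ with e | e
  · rw [e]
  · rw [e]
    refine and_congr_right fun _ => ⟨fun H l => ?_, fun H l => ?_⟩
    · rw [← neg_neg l, density_neg hρ]
      exact H _
    · rw [← density_neg hρ]
      exact H _

/-- For `ρ ≥ 0` the right wing is the binding one. -/
theorem density_le_density_neg {b ρ σ l : ℝ} (h0 : 0 ≤ ρ) (h1 : ρ < 1) (hb : 0 ≤ b) (hσ : 0 < σ)
    (hl : 0 ≤ l) : density b ρ σ l ≤ density b ρ σ (-l) := by
  have hρ : |ρ| < 1 := by rwa [abs_of_nonneg h0]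
  have hr := sqrt_sq_add_one_pos l
  unfold density
  rw [h_eq hρ, h_eq hρ, g_eq, g_eq, g₂_eq hρ, g₂_eq hρ, neg_sq]
  have e1 : b ^ 2 * ((ρ + -l / √(l ^ 2 + 1)) / 4) ^ 2 ≤
      b ^ 2 * ((ρ + l / √(l ^ 2 + 1)) / 4) ^ 2 := by
    have : 0 ≤ ρ * (l / √(l ^ 2 + 1)) := by positivity
    rw [neg_div]
    exact mul_le_mul_of_nonneg_left (by nlinarith) (sq_nonneg b)
  have e2 : b / (2 * σ) * (1 / √(l ^ 2 + 1) ^ 3 -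
      (√(l ^ 2 + 1) + ρ * l - √(1 - ρ ^ 2)) / (2 * √(l ^ 2 + 1) ^ 2)) ≤
      b / (2 * σ) * (1 / √(l ^ 2 + 1) ^ 3 -
      (√(l ^ 2 + 1) + ρ * -l - √(1 - ρ ^ 2)) / (2 * √(l ^ 2 + 1) ^ 2)) := by
    have : 0 ≤ ρ * l := by positivity
    gcongr
    linarith
  linarith

/-! ### The asymptotic constraint on `b` and the boundary case -/

theorem four_mul_sq_mul_density {ρ : ℝ} (hρ : |ρ| < 1) (b σ l : ℝ) :
    4 * √(l ^ 2 + 1) ^ 2 * density b ρ σ l =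
      (√(l ^ 2 + 1) + 1 / √(1 - ρ ^ 2)) ^ 2 - b ^ 2 / 4 * (ρ * √(l ^ 2 + 1) + l) ^ 2 +
        b / σ * (2 / √(l ^ 2 + 1) - (√(l ^ 2 + 1) + ρ * l - √(1 - ρ ^ 2))) := by
  have hS := sqrt_one_sub_sq_pos hρ
  have hr := sqrt_sq_add_one_pos l
  unfold density
  rw [h_eq hρ, g_eq, g₂_eq hρ]
  generalize √(1 - ρ ^ 2) = S at *
  generalize √(l ^ 2 + 1) = r at *
  rcases eq_or_ne σ 0 with rfl | hσ
  · simp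
    field_simp
    ring
  · field_simp
    ring

theorem tendsto_one_div_sqrt_sq_add_one :
    Tendsto (fun l : ℝ => 1 / √(l ^ 2 + 1)) atTop (𝓝 0) := by
  have : Tendsto (fun l : ℝ => √(l ^ 2 + 1)) atTop atTop :=
    tendsto_atTop_mono (fun l => (lt_sqrt_sq_add_one l).le) tendsto_id
  simp only [one_div]
  exact this.inv_tendsto_atTop

theorem sqrt_sq_add_one_sub_le {l : ℝ} (hl : 0 ≤ l) :
    √(l ^ 2 + 1) - l ≤ 1 / √(l ^ 2 + 1) := by
  have hr := sqrt_sq_add_one_pos l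
  have hr2 := sq_sqrt_sq_add_one l
  have := lt_sqrt_sq_add_one l
  rw [le_div_iff₀ hr]
  nlinarith

theorem tendsto_sqrt_sq_add_one_sub :
    Tendsto (fun l : ℝ => √(l ^ 2 + 1) - l) atTop (𝓝 0) := by
  refine tendsto_of_tendsto_of_tendsto_of_le_of_le' tendsto_const_nhds
    tendsto_one_div_sqrt_sq_add_one ?_ ?_
  · exact Eventually.of_forall fun l => sub_nonneg.2 (lt_sqrt_sq_add_one l).le
  · filter_upwards [eventually_ge_atTop 0] with l hl
    exact sqrt_sq_add_one_sub_le hl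

theorem tendsto_density {ρ : ℝ} (hρ : |ρ| < 1) (b σ : ℝ) :
    Tendsto (density b ρ σ) atTop (𝓝 (1 / 4 - b ^ 2 * (1 + ρ) ^ 2 / 16)) := by
  have hS := sqrt_one_sub_sq_pos hρ
  have e : density b ρ σ = fun l =>
      (1 / 2 + 1 / (2 * √(1 - ρ ^ 2)) * (1 / √(l ^ 2 + 1))) ^ 2 -
        b ^ 2 * ((1 + ρ - (√(l ^ 2 + 1) - l) * (1 / √(l ^ 2 + 1))) / 4) ^ 2 +
        b / (2 * σ) * ((1 / √(l ^ 2 + 1)) ^ 3 - (1 / √(l ^ 2 + 1)) / 2 *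
          (1 + ρ - (ρ * (√(l ^ 2 + 1) - l) + √(1 - ρ ^ 2)) * (1 / √(l ^ 2 + 1)))) := by
    funext l
    have hr := sqrt_sq_add_one_pos l
    unfold density
    rw [h_eq hρ, g_eq, g₂_eq hρ]
    congr 2
    · field_simp
    · congr 2
      field_simp
      ring
    · field_simp
      ring
  have hr := tendsto_one_div_sqrt_sq_add_one
  have hd := tendsto_sqrt_sq_add_one_sub
  rw [e]
  have := ((((hr.const_mul (1 / (2 * √(1 - ρ ^ 2)))).const_add (1 / 2)).pow 2).sub
    (((((hd.mul hr).const_sub (1 + ρ)).div_const 4).pow 2).const_mul (b ^ 2))).add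
    (((hr.pow 3).sub ((hr.div_const 2).mul
      ((((hd.const_mul ρ).add_const √(1 - ρ ^ 2)).mul hr).const_sub (1 + ρ)))).const_mul
        (b / (2 * σ)))
  convert this using 2
  ring

theorem le_of_density_nonneg {b ρ σ : ℝ} (h0 : 0 ≤ ρ) (h1 : ρ < 1)
    (H : ∀ l, 0 ≤ density b ρ σ l) : b ≤ 2 / (1 + ρ) := by
  have hlim := ge_of_tendsto' (tendsto_density (by rwa [abs_of_nonneg h0]) b σ) H
  rw [le_div_iff₀ (by linarith)]
  have : (b * (1 + ρ)) ^ 2 ≤ 2 ^ 2 := by nlinarith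
  exact le_of_sq_le_sq this (by norm_num)

/-- For `b = 2 / (1 + ρ)` the quadratic terms in `l` cancel. The difference `√(l² + 1) - l` is bounded
by `1 / √(l² + 1)`, so the first term decides the behaviour at `+∞`. -/
theorem four_mul_sq_mul_density_boundary {ρ : ℝ} (hρ : |ρ| < 1) (σ l : ℝ) :
    4 * √(l ^ 2 + 1) ^ 2 * density (2 / (1 + ρ)) ρ σ l =
      2 * √(l ^ 2 + 1) * (1 / √(1 - ρ ^ 2) - 1 / σ) + 1 / √(1 - ρ ^ 2) ^ 2 +
        2 * √(l ^ 2 + 1) * (√(l ^ 2 + 1) - l) / (1 + ρ) -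
        (√(l ^ 2 + 1) - l) ^ 2 / (1 + ρ) ^ 2 +
        2 / ((1 + ρ) * σ) *
          (2 / √(l ^ 2 + 1) + ρ * (√(l ^ 2 + 1) - l) + √(1 - ρ ^ 2)) := by
  have hS := sqrt_one_sub_sq_pos hρ
  have hr := sqrt_sq_add_one_pos l
  have hρ1 : 0 < 1 + ρ := by linarith [(abs_lt.1 hρ).1]
  rw [four_mul_sq_mul_density hρ]
  generalize √(1 - ρ ^ 2) = S at *
  generalize √(l ^ 2 + 1) = r at *
  rcases eq_or_ne σ 0 with rfl | hσ
  · simp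
    field_simp
    ring
  · field_simp
    ring

theorem sqrt_one_sub_sq_le_of_density_nonneg {ρ σ : ℝ} (h0 : 0 ≤ ρ) (h1 : ρ < 1) (hσ : 0 < σ)
    (H : ∀ l, 0 ≤ density (2 / (1 + ρ)) ρ σ l) : √(1 - ρ ^ 2) ≤ σ := by
  have hρ : |ρ| < 1 := by rwa [abs_of_nonneg h0]
  have hS := sqrt_one_sub_sq_pos hρ
  have hr := tendsto_one_div_sqrt_sq_add_one
  have hd := tendsto_sqrt_sq_add_one_sub
  have hlim : Tendsto (fun l : ℝ => 2 * (1 / √(1 - ρ ^ 2) - 1 / σ) +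
      1 / √(1 - ρ ^ 2) ^ 2 * (1 / √(l ^ 2 + 1)) + 2 / (1 + ρ) * (√(l ^ 2 + 1) - l) -
      1 / (1 + ρ) ^ 2 * ((√(l ^ 2 + 1) - l) ^ 2 * (1 / √(l ^ 2 + 1))) +
      2 / ((1 + ρ) * σ) * (2 * (1 / √(l ^ 2 + 1)) ^ 2 +
        (ρ * (√(l ^ 2 + 1) - l) + √(1 - ρ ^ 2)) * (1 / √(l ^ 2 + 1)))) atTop
      (𝓝 (2 * (1 / √(1 - ρ ^ 2) - 1 / σ))) := by
    have := ((((hr.const_mul (1 / √(1 - ρ ^ 2) ^ 2)).const_add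
      (2 * (1 / √(1 - ρ ^ 2) - 1 / σ))).add (hd.const_mul (2 / (1 + ρ)))).sub
      (((hd.pow 2).mul hr).const_mul (1 / (1 + ρ) ^ 2))).add
      ((((hr.pow 2).const_mul 2).add
        (((hd.const_mul ρ).add_const √(1 - ρ ^ 2)).mul hr)).const_mul (2 / ((1 + ρ) * σ)))
    convert this using 2
    ring
  have hnn := ge_of_tendsto' hlim (b := 0) fun l => by
    have hr := sqrt_sq_add_one_pos l
    have := mul_nonneg (mul_nonneg (by positivity : 0 ≤ 4 * √(l ^ 2 + 1) ^ 2) (H l))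
      (by positivity : 0 ≤ 1 / √(l ^ 2 + 1))
    rw [four_mul_sq_mul_density_boundary hρ] at this
    refine this.trans_eq ?_
    field_simp
    ring
  have : 1 / σ ≤ 1 / √(1 - ρ ^ 2) := by linarith
  exact (one_div_le_one_div hσ hS).1 this

theorem density_boundary_nonneg {ρ σ l : ℝ} (h0 : 0 ≤ ρ) (h1 : ρ < 1) (hl : 0 ≤ l)
    (hσ : √(1 - ρ ^ 2) ≤ σ) : 0 ≤ density (2 / (1 + ρ)) ρ σ l := by
  have hρ : |ρ| < 1 := by rwa [abs_of_nonneg h0]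
  have hS := sqrt_one_sub_sq_pos hρ
  have hS1 := sqrt_one_sub_sq_le_one ρ
  have hσ0 := hS.trans_le hσ
  have hr := sqrt_sq_add_one_pos l
  have hd0 := sub_nonneg.2 (lt_sqrt_sq_add_one l).le
  have hd1 : √(l ^ 2 + 1) - l ≤ 1 := (sqrt_sq_add_one_sub_le hl).trans
    ((div_le_one hr).2 (one_le_sqrt_sq_add_one l))
  refine nonneg_of_mul_nonneg_right (a := 4 * √(l ^ 2 + 1) ^ 2) ?_ (by positivity)
  rw [four_mul_sq_mul_density_boundary hρ]
  have e1 : 1 / σ ≤ 1 / √(1 - ρ ^ 2) := one_div_le_one_div_of_le hS hσ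
  have e2 : (√(l ^ 2 + 1) - l) ^ 2 / (1 + ρ) ^ 2 ≤ 1 := by
    rw [← div_pow]
    exact pow_le_one₀ (by positivity) ((div_le_one (by linarith)).2 (by linarith))
  have e3 : 1 ≤ 1 / √(1 - ρ ^ 2) ^ 2 :=
    (one_le_div (by positivity)).2 (pow_le_one₀ hS.le hS1)
  have e4 : 0 ≤ 2 * √(l ^ 2 + 1) * (1 / √(1 - ρ ^ 2) - 1 / σ) :=
    mul_nonneg (by positivity) (by linarith)
  have e5 : 0 ≤ 2 * √(l ^ 2 + 1) * (√(l ^ 2 + 1) - l) / (1 + ρ) := by positivity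
  have e6 : 0 ≤ 2 / ((1 + ρ) * σ) *
      (2 / √(l ^ 2 + 1) + ρ * (√(l ^ 2 + 1) - l) + √(1 - ρ ^ 2)) := by positivity
  linarith

/-- The right half-line suffices for the nonnegativity of the density when `ρ ≥ 0`. -/
theorem density_nonneg_of_forall_nonneg {b ρ σ : ℝ} (h0 : 0 ≤ ρ) (h1 : ρ < 1) (hb : 0 ≤ b)
    (hσ : 0 < σ) (H : ∀ l, 0 ≤ l → 0 ≤ density b ρ σ l) (l : ℝ) : 0 ≤ density b ρ σ l := by
  rcases le_total 0 l with hl | hl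
  · exact H l hl
  · have := density_le_density_neg h0 h1 hb hσ (neg_nonneg.2 hl)
    rw [neg_neg] at this
    exact (H _ (neg_nonneg.2 hl)).trans this

/-! ### The zero `l₂` of `g₂` -/

theorem arccos_neg_div_three_mem {ρ : ℝ} (h0 : 0 ≤ ρ) :
    Real.arccos (-ρ) / 3 ∈ Ioo 0 (Real.pi / 2) := by
  have h2 : Real.pi / 2 ≤ Real.arccos (-ρ) := by
    rw [← Real.arccos_zero]
    exact Real.arccos_le_arccos (by linarith)
  have h3 := Real.arccos_le_pi (-ρ)
  have := Real.pi_pos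
  constructor <;> linarith

theorem l₂_pos {ρ : ℝ} (h0 : 0 ≤ ρ) : 0 < l₂ ρ := by
  obtain ⟨h1, h2⟩ := arccos_neg_div_three_mem h0
  exact one_div_pos.2 (Real.tan_pos_of_pos_of_lt_pi_div_two h1 h2)

theorem g₂_eq_neg_div {ρ : ℝ} (hρ : |ρ| < 1) (l : ℝ) :
    g₂ ρ l = -(√(l ^ 2 + 1) * (√(l ^ 2 + 1) + ρ * l - √(1 - ρ ^ 2)) - 2) /
      (2 * √(l ^ 2 + 1) ^ 3) := by
  have hr := sqrt_sq_add_one_pos l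
  rw [g₂_eq hρ]
  field_simp
  ring

/-- With `l = cot θ` and `ρ = -cos α` one has `g₂ = 0` at `θ = α / 3`, because there
`2 sin² θ - 1 = -cos 2θ = -cos (α - θ)`. -/
theorem g₂_l₂ {ρ : ℝ} (h0 : 0 ≤ ρ) (h1 : ρ < 1) : g₂ ρ (l₂ ρ) = 0 := by
  have hρ : |ρ| < 1 := by rwa [abs_of_nonneg h0]
  obtain ⟨ht0, ht1⟩ := arccos_neg_div_three_mem h0
  have hα : Real.arccos (-ρ) = 3 * (Real.arccos (-ρ) / 3) := by ring
  have hcos : Real.cos (Real.arccos (-ρ)) = -ρ := Real.cos_arccos (by linarith) (by linarith)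
  have hsin : Real.sin (Real.arccos (-ρ)) = √(1 - ρ ^ 2) := by rw [Real.sin_arccos, neg_sq]
  rw [g₂_eq_neg_div hρ, l₂]
  rw [hα] at hcos hsin
  generalize Real.arccos (-ρ) / 3 = θ at *
  have hs : 0 < Real.sin θ := Real.sin_pos_of_pos_of_lt_pi ht0 (by linarith [Real.pi_pos])
  have hc : 0 < Real.cos θ := Real.cos_pos_of_mem_Ioo ⟨by linarith [Real.pi_pos], ht1⟩
  have hsc := Real.sin_sq_add_cos_sq θ
  have hl : 1 / Real.tan θ = Real.cos θ / Real.sin θ := by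
    rw [Real.tan_eq_sin_div_cos, one_div_div]
  have hr : √((Real.cos θ / Real.sin θ) ^ 2 + 1) = 1 / Real.sin θ := by
    rw [Real.sqrt_eq_iff_mul_self_eq (by positivity) (by positivity)]
    field_simp
    linarith
  have key : Real.cos (3 * θ - θ) = 2 * Real.cos θ ^ 2 - 1 := by
    rw [← Real.cos_two_mul]
    ring_nf
  rw [Real.cos_sub, hcos, hsin] at key
  have hnum : 1 / Real.sin θ * (1 / Real.sin θ + ρ * (Real.cos θ / Real.sin θ) - √(1 - ρ ^ 2)) -
      2 = 0 := by
    field_simp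
    linear_combination -key - 2 * hsc
  rw [hl, hr, hnum, neg_zero, zero_div]

theorem sqrt_sq_add_one_le {x y : ℝ} (hx : 0 ≤ x) (hxy : x ≤ y) :
    √(x ^ 2 + 1) ≤ √(y ^ 2 + 1) :=
  Real.sqrt_le_sqrt (by gcongr)

theorem strictMonoOn_neg_g₂_numerator {ρ : ℝ} (h0 : 0 ≤ ρ) :
    StrictMonoOn (fun l : ℝ => √(l ^ 2 + 1) * (√(l ^ 2 + 1) + ρ * l - √(1 - ρ ^ 2)) - 2)
      (Ici 0) := by
  intro x hx y hy hxy
  have hx : 0 ≤ x := hx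
  have hr : √(x ^ 2 + 1) < √(y ^ 2 + 1) := Real.sqrt_lt_sqrt (by positivity) (by gcongr)
  have hr1 := one_le_sqrt_sq_add_one x
  have hS := sqrt_one_sub_sq_le_one ρ
  have hm : ρ * x ≤ ρ * y := by gcongr
  have hm0 : 0 ≤ ρ * x := by positivity
  have e1 : √(x ^ 2 + 1) + ρ * x - √(1 - ρ ^ 2) < √(y ^ 2 + 1) + ρ * y - √(1 - ρ ^ 2) := by
    linarith
  have := mul_lt_mul'' hr e1 (by linarith) (by linarith)
  simpa using this

theorem g₂_neg {ρ l : ℝ} (h0 : 0 ≤ ρ) (h1 : ρ < 1) (hl : l₂ ρ < l) : g₂ ρ l < 0 := by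
  have hρ : |ρ| < 1 := by rwa [abs_of_nonneg h0]
  have hz := g₂_l₂ h0 h1
  have hr := sqrt_sq_add_one_pos l
  have hr' := sqrt_sq_add_one_pos (l₂ ρ)
  have hpos := l₂_pos h0
  have := strictMonoOn_neg_g₂_numerator h0 hpos.le (hpos.le.trans hl.le) hl
  rw [g₂_eq_neg_div hρ, div_eq_zero_iff, or_iff_left (by positivity)] at hz
  rw [g₂_eq_neg_div hρ]
  refine div_neg_of_neg_of_pos ?_ (by positivity)
  dsimp only at this
  linarith

theorem g₂_nonneg {ρ l : ℝ} (h0 : 0 ≤ ρ) (h1 : ρ < 1) (hl0 : 0 ≤ l) (hl : l ≤ l₂ ρ) :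
    0 ≤ g₂ ρ l := by
  have hρ : |ρ| < 1 := by rwa [abs_of_nonneg h0]
  have hz := g₂_l₂ h0 h1
  have hr := sqrt_sq_add_one_pos l
  have hr' := sqrt_sq_add_one_pos (l₂ ρ)
  have := (strictMonoOn_neg_g₂_numerator h0).monotoneOn hl0 (l₂_pos h0).le hl
  rw [g₂_eq_neg_div hρ, div_eq_zero_iff, or_iff_left (by positivity)] at hz
  rw [g₂_eq_neg_div hρ]
  refine div_nonneg ?_ (by positivity)
  linarith

/-! ### The functions `h`, `g` and `f̃` on the right half-line -/

theorem half_le_h {ρ : ℝ} (hρ : |ρ| < 1) (l : ℝ) : 1 / 2 ≤ h ρ l := by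
  have := sqrt_one_sub_sq_pos hρ
  have := sqrt_sq_add_one_pos l
  rw [h_eq hρ]
  exact le_add_of_nonneg_right (by positivity)

theorem h_antitone {ρ x y : ℝ} (hρ : |ρ| < 1) (hx : 0 ≤ x) (hxy : x ≤ y) : h ρ y ≤ h ρ x := by
  have := sqrt_one_sub_sq_pos hρ
  have := sqrt_sq_add_one_pos x
  have := sqrt_sq_add_one_le hx hxy
  rw [h_eq hρ, h_eq hρ]
  gcongr

theorem hasDerivAt_h {ρ : ℝ} (hρ : |ρ| < 1) (l : ℝ) :
    HasDerivAt (h ρ) (-l / (2 * √(1 - ρ ^ 2) * √(l ^ 2 + 1) ^ 3)) l := by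
  have hS := sqrt_one_sub_sq_pos hρ
  have hr := sqrt_sq_add_one_pos l
  have h1 : HasDerivAt (fun x : ℝ => x ^ 2 + 1) (2 * l) l := by
    simpa using (hasDerivAt_pow 2 l).add_const 1
  have h2 := ((((h1.sqrt (by positivity)).const_mul (2 * √(1 - ρ ^ 2))).fun_inv
    (by positivity)).const_add (1 / 2))
  rw [funext (h_eq hρ)]
  simp only [one_div] at h2 ⊢
  refine h2.congr_deriv ?_
  field_simp

theorem hasDerivAt_g (ρ l : ℝ) : HasDerivAt (g ρ) (SVI.N'' l / 4) l :=
  (SVI.hasDerivAt_N' ρ l).div_const 4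

theorem differentiableAt_g₂ {ρ : ℝ} (hρ : |ρ| < 1) (l : ℝ) : DifferentiableAt ℝ (g₂ ρ) l := by
  have h1 : l ^ 2 + 1 ≠ 0 := by positivity
  have h2 : √(l ^ 2 + 1) ^ 3 ≠ 0 := by positivity
  have h3 : 2 * √(l ^ 2 + 1) ^ 2 ≠ 0 := by positivity
  rw [funext (g₂_eq hρ)]
  fun_prop (disch := assumption)

theorem N''_pos (l : ℝ) : 0 < SVI.N'' l := by
  have := sqrt_sq_add_one_pos l
  unfold SVI.N''
  positivity

theorem g_strictMono (ρ : ℝ) : StrictMono (g ρ) :=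
  strictMono_of_deriv_pos fun l => by
    rw [(hasDerivAt_g ρ l).deriv]
    exact div_pos (N''_pos l) four_pos

theorem g_pos {ρ l : ℝ} (h0 : 0 ≤ ρ) (hl : 0 < l) : 0 < g ρ l := by
  have := sqrt_sq_add_one_pos l
  rw [g_eq]
  positivity

theorem g_le {ρ : ℝ} (l : ℝ) : g ρ l ≤ (1 + ρ) / 4 := by
  have := (div_le_one (sqrt_sq_add_one_pos l)).2 (lt_sqrt_sq_add_one l).le
  rw [g_eq]
  linarith

theorem one_div_four_sub_pos {b ρ : ℝ} (h0 : 0 ≤ ρ) (hb : 0 ≤ b) (hb1 : b < 2 / (1 + ρ)) :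
    0 < 1 / 4 - b ^ 2 * ((1 + ρ) / 4) ^ 2 := by
  rw [lt_div_iff₀ (by linarith)] at hb1
  have : 0 ≤ b * (1 + ρ) := by positivity
  nlinarith

theorem le_h_sq_sub {b ρ l : ℝ} (h0 : 0 ≤ ρ) (h1 : ρ < 1) (hl : 0 ≤ l) :
    1 / 4 - b ^ 2 * ((1 + ρ) / 4) ^ 2 ≤ h ρ l ^ 2 - b ^ 2 * g ρ l ^ 2 := by
  have hh := half_le_h (ρ := ρ) (by rwa [abs_of_nonneg h0]) l
  have hg := g_le (ρ := ρ) l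
  have hg0 : 0 ≤ g ρ l := by
    have := sqrt_sq_add_one_pos l
    rw [g_eq]
    positivity
  have e1 : (1 / 2 : ℝ) ^ 2 ≤ h ρ l ^ 2 := by gcongr
  have e2 : b ^ 2 * g ρ l ^ 2 ≤ b ^ 2 * ((1 + ρ) / 4) ^ 2 := by gcongr
  linarith

theorem fTilde_eq (b ρ l : ℝ) :
    fTilde b ρ l = -((h ρ l ^ 2 - b ^ 2 * g ρ l ^ 2) / g₂ ρ l) := by
  have : SVI.G₁ √(1 - ρ ^ 2) b ρ (-(ρ / √(1 - ρ ^ 2))) l = h ρ l ^ 2 - b ^ 2 * g ρ l ^ 2 := by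
    unfold SVI.G₁ h g
    ring
  unfold fTilde SVI.fTilde
  rw [this]
  rfl

theorem hasDerivAt_fTilde {ρ l : ℝ} (hρ : |ρ| < 1) (b : ℝ) (hl : g₂ ρ l ≠ 0) :
    HasDerivAt (fTilde b ρ) ((bStarNum ρ l - b ^ 2 * bStarDen ρ l) / g₂ ρ l ^ 2) l := by
  have hh := (hasDerivAt_h hρ l).differentiableAt.hasDerivAt
  have hg := (hasDerivAt_g ρ l).differentiableAt.hasDerivAt
  have hg₂ := (differentiableAt_g₂ hρ l).hasDerivAt
  have := (((hh.pow 2).sub ((hg.pow 2).const_mul (b ^ 2))).div hg₂ hl).neg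
  rw [funext (fTilde_eq b ρ)]
  refine this.congr_deriv ?_
  unfold bStarNum bStarDen
  simp only [Pi.sub_apply, Pi.pow_apply]
  field_simp
  ring

theorem hasDerivAt_fTilde_zero_iff {ρ l : ℝ} (h0 : 0 ≤ ρ) (h1 : ρ < 1) (b : ℝ) (hl : l₂ ρ < l) :
    HasDerivAt (fTilde b ρ) 0 l ↔ bStarNum ρ l = b ^ 2 * bStarDen ρ l := by
  have hg := (g₂_neg h0 h1 hl).ne
  have hd := hasDerivAt_fTilde (by rwa [abs_of_nonneg h0]) b hg
  constructor
  · intro H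
    have := hd.unique H
    rw [div_eq_zero_iff, or_iff_left (pow_ne_zero 2 hg)] at this
    linarith
  · intro H
    refine hd.congr_deriv ?_
    rw [H, sub_self, zero_div]

/-- Where `h² / g₂` is stationary, `g² / g₂` is not, because `g / h` is strictly increasing. -/
theorem bStarDen_pos {ρ l : ℝ} (h0 : 0 ≤ ρ) (h1 : ρ < 1) (hl : l₂ ρ < l)
    (hnum : bStarNum ρ l = 0) : 0 < bStarDen ρ l := by
  have hρ : |ρ| < 1 := by rwa [abs_of_nonneg h0]
  have hl0 := (l₂_pos h0).trans hl
  have hh : 0 < h ρ l := one_half_pos.trans_le (half_le_h hρ l)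
  have hg := g_pos h0 hl0
  have hg₂ := g₂_neg h0 h1 hl
  have hh' : deriv (h ρ) l ≤ 0 := by
    have := sqrt_one_sub_sq_pos hρ
    have := sqrt_sq_add_one_pos l
    rw [(hasDerivAt_h hρ l).deriv, neg_div]
    exact neg_nonpos.2 (by positivity)
  have hg' : 0 < deriv (g ρ) l := by
    rw [(hasDerivAt_g ρ l).deriv]
    exact div_pos (N''_pos l) four_pos
  unfold bStarNum at hnum
  have hz := (mul_eq_zero.1 hnum).resolve_left hh.ne'
  have key : h ρ l * bStarDen ρ l =
      2 * g ρ l * -g₂ ρ l * (deriv (g ρ) l * h ρ l + g ρ l * -deriv (h ρ) l) := by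
    unfold bStarDen
    linear_combination g ρ l ^ 2 * hz
  have : 0 < h ρ l * bStarDen ρ l := by
    rw [key]
    have := mul_pos hg' hh
    have := mul_nonneg hg.le (neg_nonneg.2 hh')
    have := neg_pos.2 hg₂
    positivity
  exact pos_of_mul_pos_right this hh.le

/-! ### The minimum of `f̃` -/

theorem neg_one_div_le_g₂ {ρ l : ℝ} (h0 : 0 ≤ ρ) (h1 : ρ < 1) (hl : 0 < l) :
    -(1 / l) ≤ g₂ ρ l := by
  have hρ : |ρ| < 1 := by rwa [abs_of_nonneg h0]
  have hr := sqrt_sq_add_one_pos l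
  have hlr := lt_sqrt_sq_add_one l
  have hS := sqrt_one_sub_sq_pos hρ
  have e1 : ρ * l ≤ √(l ^ 2 + 1) := by nlinarith
  have e2 : (√(l ^ 2 + 1) + ρ * l - √(1 - ρ ^ 2)) / (2 * √(l ^ 2 + 1) ^ 2) ≤ 1 / l := by
    rw [div_le_div_iff₀ (by positivity) hl]
    nlinarith [mul_pos hr hl]
  have e3 : 0 < 1 / √(l ^ 2 + 1) ^ 3 := by positivity
  rw [g₂_eq hρ]
  linarith

/-- `f̃` tends to `+∞` at both ends of `]l₂, ∞[`. Its minimum is found as that of the continuous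
function `-1 / f̃ = g₂ / (h² - b² g²)`, which vanishes at both ends. -/
theorem exists_forall_fTilde_le {b ρ : ℝ} (h0 : 0 ≤ ρ) (h1 : ρ < 1) (hb : 0 ≤ b)
    (hb1 : b < 2 / (1 + ρ)) : ∃ m, l₂ ρ < m ∧ ∀ l, l₂ ρ < l → fTilde b ρ m ≤ fTilde b ρ l := by
  have hρ : |ρ| < 1 := by rwa [abs_of_nonneg h0]
  have hl₂ := l₂_pos h0
  have hc := one_div_four_sub_pos h0 hb hb1
  set c := 1 / 4 - b ^ 2 * ((1 + ρ) / 4) ^ 2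
  have hG : ∀ l, 0 ≤ l → c ≤ h ρ l ^ 2 - b ^ 2 * g ρ l ^ 2 := fun l hl => le_h_sq_sub h0 h1 hl
  set ψ : ℝ → ℝ := fun l => g₂ ρ l / (h ρ l ^ 2 - b ^ 2 * g ρ l ^ 2) with hψ
  have hneg : ∀ l, l₂ ρ < l → ψ l < 0 := fun l hl =>
    div_neg_of_neg_of_pos (g₂_neg h0 h1 hl) (hc.trans_le (hG l (hl₂.le.trans hl.le)))
  set a := l₂ ρ + 1
  have ha : ψ a < 0 := hneg a (lt_add_one _)
  -- Beyond `R` the bound `g₂ ≥ -1 / l` keeps `ψ` above its value at `a`.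
  set R := max a (1 / (c * -ψ a))
  have hR : ∀ l, R ≤ l → ψ a ≤ ψ l := by
    intro l hl
    have hl0 : 0 < l := by linarith [le_max_left a (1 / (c * -ψ a))]
    have e1 : 1 / (c * -ψ a) ≤ l := (le_max_right _ _).trans hl
    have hca : 0 < c * -ψ a := mul_pos hc (neg_pos.2 ha)
    have e2 : 1 / l ≤ c * -ψ a := by
      rw [div_le_iff₀ hca] at e1
      rw [div_le_iff₀ hl0]
      linarith
    have e3 := neg_one_div_le_g₂ h0 h1 hl0
    rw [hψ, le_div_iff₀ (hc.trans_le (hG l hl0.le))]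
    have := mul_le_mul_of_nonneg_right (hG l hl0.le) (neg_pos.2 ha).le
    linarith
  have hcont : ContinuousOn ψ (Icc (l₂ ρ) R) := fun l hl =>
    ((differentiableAt_g₂ hρ l).continuousAt.div
      (((hasDerivAt_h hρ l).continuousAt.pow 2).sub
        (((hasDerivAt_g ρ l).continuousAt.pow 2).const_mul (b ^ 2)))
      (hc.trans_le (hG l (hl₂.le.trans hl.1))).ne').continuousWithinAt
  have haR : a ∈ Icc (l₂ ρ) R := ⟨(lt_add_one _).le, le_max_left _ _⟩
  obtain ⟨m, hm, hmin⟩ := isCompact_Icc.exists_isMinOn ⟨a, haR⟩ hcont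
  have hma : ψ m ≤ ψ a := hmin haR
  have hm2 : l₂ ρ < m := by
    refine hm.1.lt_of_ne fun e => ?_
    have : ψ m = 0 := by
      rw [← e]
      simp only [hψ]
      rw [g₂_l₂ h0 h1, zero_div]
    linarith
  have hf : ∀ l, fTilde b ρ l = 1 / -ψ l := fun l => by
    rw [fTilde_eq, hψ, one_div, inv_neg, inv_div]
  refine ⟨m, hm2, fun l hl => ?_⟩
  have hml : ψ m ≤ ψ l := by
    rcases le_total l R with h | h
    · exact hmin ⟨hl.le, h⟩
    · exact hma.trans (hR l h)
  rw [hf, hf]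
  exact one_div_le_one_div_of_le (neg_pos.2 (hneg l hl)) (neg_le_neg hml)

theorem fTilde_le_of_critical {b ρ m : ℝ} (h0 : 0 ≤ ρ) (h1 : ρ < 1) (hb : 0 ≤ b)
    (hb1 : b < 2 / (1 + ρ)) (hu : UniqueCriticalPoint b ρ) (hm : l₂ ρ < m)
    (hcrit : HasDerivAt (fTilde b ρ) 0 m) {l : ℝ} (hl : l₂ ρ < l) :
    fTilde b ρ m ≤ fTilde b ρ l := by
  obtain ⟨m', hm', hmin⟩ := exists_forall_fTilde_le h0 h1 hb hb1
  have hd := hasDerivAt_fTilde (by rwa [abs_of_nonneg h0]) b (g₂_neg h0 h1 hm').ne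
  have hloc : IsLocalMin (fTilde b ρ) m' := by
    filter_upwards [lt_mem_nhds hm'] with x hx using hmin x hx
  have := hd
  rw [hloc.hasDerivAt_eq_zero hd] at this
  rw [hu.unique ⟨hm, hcrit⟩ ⟨hm', this⟩]
  exact hmin l hl

/-- The minimum point of `f̃ = (h² / -g₂) (1 - b² (g / h)²)` moves to the right as `b` leaves `0`,
because `g / h` is strictly increasing. -/
theorem minimizer_zero_le {b ρ x m : ℝ} (h0 : 0 ≤ ρ) (h1 : ρ < 1) (hb : 0 < b)
    (hb1 : b < 2 / (1 + ρ)) (hx : l₂ ρ < x) (hm : l₂ ρ < m)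
    (hx0 : fTilde 0 ρ x ≤ fTilde 0 ρ m) (hmb : fTilde b ρ m ≤ fTilde b ρ x) : x ≤ m := by
  have hρ : |ρ| < 1 := by rwa [abs_of_nonneg h0]
  have hl₂ := l₂_pos h0
  by_contra! hlt
  have hh : ∀ l, 0 < h ρ l := fun l => one_half_pos.trans_le (half_le_h hρ l)
  have hf : ∀ l, fTilde b ρ l = fTilde 0 ρ l * (1 - b ^ 2 * (g ρ l / h ρ l) ^ 2) := fun l => by
    have := (hh l).ne'
    rw [fTilde_eq, fTilde_eq]
    field_simp
    ring
  have hpos : ∀ l, l₂ ρ < l → 0 < fTilde 0 ρ l := fun l hl => by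
    rw [fTilde_eq, zero_pow two_ne_zero, zero_mul, sub_zero]
    exact neg_pos.2 (div_neg_of_pos_of_neg (pow_pos (hh l) 2) (g₂_neg h0 h1 hl))
  have hτ : (g ρ m / h ρ m) ^ 2 < (g ρ x / h ρ x) ^ 2 := by
    have hm0 := hl₂.trans hm
    have e1 := g_strictMono ρ hlt
    have e2 := h_antitone hρ hm0.le hlt.le
    have e3 := g_pos h0 hm0
    have := hh m
    have := hh x
    gcongr ?_ ^ 2
    exact div_lt_div₀ e1 e2 (e3.trans e1).le (hh x)
  have hnn : 0 ≤ 1 - b ^ 2 * (g ρ m / h ρ m) ^ 2 := by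
    have e1 := le_h_sq_sub (b := b) h0 h1 (hl₂.trans hm).le
    have e2 := one_div_four_sub_pos h0 hb.le hb1
    have e3 := pow_pos (hh m) 2
    rw [div_pow, ← mul_div_assoc, sub_nonneg, div_le_one e3]
    linarith
  have e1 : fTilde 0 ρ x * (1 - b ^ 2 * (g ρ m / h ρ m) ^ 2) ≤ fTilde b ρ m := by
    rw [hf m]
    exact mul_le_mul_of_nonneg_right hx0 hnn
  have e2 : fTilde b ρ x < fTilde 0 ρ x * (1 - b ^ 2 * (g ρ m / h ρ m) ^ 2) := by
    rw [hf x]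
    have := mul_lt_mul_of_pos_left hτ (pow_pos hb 2)
    exact mul_lt_mul_of_pos_left (by linarith) (hpos x hx)
  linarith

/-! ### The domain in terms of `b*` and `σ*` -/

theorem density_nonneg_iff_fTilde {b ρ σ : ℝ} (h0 : 0 ≤ ρ) (h1 : ρ < 1) (hb : 0 ≤ b)
    (hb1 : b < 2 / (1 + ρ)) (hσ : 0 < σ) :
    (∀ l, 0 ≤ density b ρ σ l) ↔ ∀ l, l₂ ρ < l → b / (2 * σ) ≤ fTilde b ρ l := by
  have hl₂ := l₂_pos h0
  have key : ∀ l, l₂ ρ < l → (0 ≤ density b ρ σ l ↔ b / (2 * σ) ≤ fTilde b ρ l) := by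
    intro l hl
    rw [fTilde_eq, ← div_neg, le_div_iff₀ (neg_pos.2 (g₂_neg h0 h1 hl)), density]
    constructor <;> intro <;> linarith
  constructor
  · exact fun H l hl => (key l hl).1 (H l)
  · refine fun H => density_nonneg_of_forall_nonneg h0 h1 hb hσ fun l hl0 => ?_
    rcases lt_or_ge (l₂ ρ) l with hl | hl
    · exact (key l hl).2 (H l hl)
    · have e1 := (one_div_four_sub_pos h0 hb hb1).trans_le (le_h_sq_sub h0 h1 hl0)
      have e2 : 0 ≤ b / (2 * σ) * g₂ ρ l := mul_nonneg (by positivity) (g₂_nonneg h0 h1 hl0 hl)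
      unfold density
      linarith

/-- At a point with `b* = b` the bound `σ*` is `b / (2 f̃)`. -/
theorem sigmaStar_le_iff {b ρ σ l : ℝ} (h0 : 0 ≤ ρ) (h1 : ρ < 1) (hb : 0 ≤ b)
    (hb1 : b < 2 / (1 + ρ)) (hσ : 0 < σ) (hl : l₂ ρ < l) (hbl : bStar ρ l = b) :
    sigmaStar ρ l ≤ σ ↔ b / (2 * σ) ≤ fTilde b ρ l := by
  have hG := (one_div_four_sub_pos h0 hb hb1).trans_le
    (le_h_sq_sub h0 h1 ((l₂_pos h0).trans hl).le)
  have e : -(b * g₂ ρ l / (2 * (h ρ l ^ 2 - b ^ 2 * g ρ l ^ 2))) =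
      b * -g₂ ρ l / (2 * (h ρ l ^ 2 - b ^ 2 * g ρ l ^ 2)) := by ring
  rw [sigmaStar, hbl, fTilde_eq, e, ← div_neg, div_le_iff₀ (by linarith),
    div_le_div_iff₀ (by linarith) (neg_pos.2 (g₂_neg h0 h1 hl))]
  constructor <;> intro <;> linarith

theorem bStarNum_eq_of_bStar_eq {b ρ l : ℝ} (hb : 0 < b) (h : bStar ρ l = b) :
    bStarNum ρ l = b ^ 2 * bStarDen ρ l := by
  have hpos : 0 < bStarNum ρ l / bStarDen ρ l := by
    rw [← Real.sqrt_pos]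
    exact hb.trans_eq h.symm
  have hden : bStarDen ρ l ≠ 0 := fun e => by simp [e] at hpos
  rw [← h, bStar, Real.sq_sqrt hpos.le, div_mul_cancel₀ _ hden]

theorem exists_isBStarRoot {ρ : ℝ} (h0 : 0 ≤ ρ) (h1 : ρ < 1)
    (H : ∀ β : ℝ, 0 ≤ β → β < 2 / (1 + ρ) → UniqueCriticalPoint β ρ) :
    ∃ lbar : ℝ, IsBStarRoot ρ lbar ∧ (∀ l, IsBStarRoot ρ l → l = lbar) ∧
      ∀ b σ : ℝ, 0 < σ → 0 < b → b < 2 / (1 + ρ) →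
        ((∀ l, 0 ≤ density b ρ σ l) ↔
          ∃ l : ℝ, lbar ≤ l ∧ sigmaStar ρ l ≤ σ ∧ b = bStar ρ l) := by
  have hz : (0 : ℝ) < 2 / (1 + ρ) := by positivity
  have hu := H 0 le_rfl hz
  obtain ⟨x, ⟨hx, hxcrit⟩, -⟩ := hu
  have hcrit0 : ∀ l, l₂ ρ < l → bStarNum ρ l = 0 → l = x := fun l hl hnum =>
    (H 0 le_rfl hz).unique ⟨hl, (hasDerivAt_fTilde_zero_iff h0 h1 0 hl).2 (by rw [hnum]; ring)⟩
      ⟨hx, hxcrit⟩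
  have hxnum : bStarNum ρ x = 0 := by
    rw [(hasDerivAt_fTilde_zero_iff h0 h1 0 hx).1 hxcrit]
    ring
  have hxden := bStarDen_pos h0 h1 hx hxnum
  refine ⟨x, ⟨hx, ⟨hxden.ne', by rw [hxnum, zero_div]⟩, by rw [bStar, hxnum]; simp⟩, ?_, ?_⟩
  · rintro l ⟨hl, ⟨hden, hnn⟩, hzero⟩
    rw [bStar, Real.sqrt_eq_zero hnn, div_eq_zero_iff, or_iff_left hden] at hzero
    exact hcrit0 l hl hzero
  · intro b σ hσ hb hb1
    have hub := H b hb.le hb1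
    rw [density_nonneg_iff_fTilde h0 h1 hb.le hb1 hσ]
    constructor
    · intro hf
      obtain ⟨m, ⟨hm, hmcrit⟩, -⟩ := hub
      have hmnum := (hasDerivAt_fTilde_zero_iff h0 h1 b hm).1 hmcrit
      have hmden : bStarDen ρ m ≠ 0 := fun e => by
        rw [e, mul_zero] at hmnum
        exact (bStarDen_pos h0 h1 hm hmnum).ne' e
      have hbm : bStar ρ m = b := by
        rw [bStar, hmnum, mul_div_cancel_right₀ _ hmden, Real.sqrt_sq hb.le]
      exact ⟨m, minimizer_zero_le h0 h1 hb hb1 hx hm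
          (fTilde_le_of_critical h0 h1 le_rfl hz (H 0 le_rfl hz) hx hxcrit hm)
          (fTilde_le_of_critical h0 h1 hb.le hb1 (H b hb.le hb1) hm hmcrit hx),
        (sigmaStar_le_iff h0 h1 hb.le hb1 hσ hm hbm).2 (hf m hm), hbm.symm⟩
    · rintro ⟨m, hxm, hσm, hbm⟩ l hl
      have hm := hx.trans_le hxm
      have hmcrit := (hasDerivAt_fTilde_zero_iff h0 h1 b hm).2
        (bStarNum_eq_of_bStar_eq hb hbm.symm)
      exact ((sigmaStar_le_iff h0 h1 hb.le hb1 hσ hm hbm.symm).1 hσm).trans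
        (fTilde_le_of_critical h0 h1 hb.le hb1 hub hm hmcrit hl)

end SSVI

theorem mainTheorem4 (ρ : ℝ) (hρ : |ρ| < 1) :
    -- an arbitrage-free SSVI has `0 < b ≤ 2 / (1 + |ρ|)`
    (∀ b σ : ℝ, 0 < σ → SVI.ButterflyArbitrageFree (SVI.ssvi b ρ σ) →
      0 < b ∧ b ≤ 2 / (1 + |ρ|)) ∧
    -- the case `b = 2 / (1 + |ρ|)`
    (∀ b σ : ℝ, 0 < σ → b = 2 / (1 + |ρ|) →
      (SVI.ButterflyArbitrageFree (SVI.ssvi b ρ σ) ↔ √(1 - ρ ^ 2) ≤ σ)) ∧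
    -- the case `b < 2 / (1 + |ρ|)`, if the critical point of `f̃` is always unique
    ((∀ β : ℝ, 0 ≤ β → β < 2 / (1 + |ρ|) → SSVI.UniqueCriticalPoint β |ρ|) →
      ∃ lbar : ℝ, SSVI.IsBStarRoot |ρ| lbar ∧ (∀ l, SSVI.IsBStarRoot |ρ| l → l = lbar) ∧
        ∀ b σ : ℝ, 0 < σ → 0 < b → b < 2 / (1 + |ρ|) →
          (SVI.ButterflyArbitrageFree (SVI.ssvi b ρ σ) ↔
            ∃ l : ℝ, lbar ≤ l ∧ SSVI.sigmaStar |ρ| l ≤ σ ∧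
              ∀ k, SVI.ssvi b ρ σ k = SVI.ssvi (SSVI.bStar |ρ| l) ρ σ k)) := by
  have h0 := abs_nonneg ρ
  refine ⟨fun b σ hσ hfree => ?_, fun b σ hσ hb => ?_, fun H => ?_⟩
  · obtain ⟨hb, hd⟩ := (SSVI.butterflyArbitrageFree_ssvi_iff hρ hσ b).1 hfree
    exact ⟨hb, SSVI.le_of_density_nonneg h0 hρ hd⟩
  · have hb0 : 0 < b := by
      rw [hb]
      positivity
    rw [SSVI.butterflyArbitrageFree_ssvi_iff hρ hσ, and_iff_right hb0, hb, ← sq_abs ρ]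
    exact ⟨SSVI.sqrt_one_sub_sq_le_of_density_nonneg h0 hρ hσ, fun hσS =>
      SSVI.density_nonneg_of_forall_nonneg h0 hρ (by positivity) hσ fun l hl =>
        SSVI.density_boundary_nonneg h0 hρ hl hσS⟩
  · obtain ⟨lbar, hroot, huniq, hdom⟩ := SSVI.exists_isBStarRoot h0 hρ H
    refine ⟨lbar, hroot, huniq, fun b σ hσ hb hb1 => ?_⟩
    rw [SSVI.butterflyArbitrageFree_ssvi_iff hρ hσ, and_iff_right hb, hdom b σ hσ hb hb1]
    simp only [SSVI.ssvi_eq_ssvi_iff hρ hσ]
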